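/- Let $E=(E^0,E^1,r,s)$ be an arbitrary directed graph: sets $E^0$ (vertices) and $E^1$ (edges) of any cardinality, with maps $r,s\colon E^1\to E^0$ (range and source). Let $E^\star$ be the set of finite paths $\alpha=\alpha_1\cdots\alpha_n$, where $r(\alpha_i)=s(\alpha_{i+1})$, including the vertices as paths of length $0$, and let $E^\infty$ be the set of infinite paths $p_1p_2\cdots$. Write $vE^1=\{e\in E^1: s(e)=v\}$, and call $v$ singular if $vE^1$ is empty or infinite. The boundary path space is $\partial E=E^\infty\cup\{\alpha\in E^\star: r(\alpha)\text{ is singular}\}$, with the subspace topology from $E^\star\cup E^\infty$, whose topology is generated by the sets $C(\alpha,F)=C(\alpha)\setminus\bigcup_{e\in F}C(\alpha e)$, for $\alpha\in E^\star$ and $F\subseteq r(\alpha)E^1$ finite, where $C(\alpha)$ is the set of all finite and infinite paths that extend $\alpha$. Let $\sigma$ be the shift that deletes the first edge of a path. For $x,y\in\partial E$ and $k\in\mathbb Z$ write $x\sim_k y$ if $\sigma^n(x)=\sigma^{n-k}(y)$ for some $n\ge\max\{0,k\}$ with $n\le|x|$ and $n-k\le|y|$. The boundary path groupoid is $\mathcal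 G_E=\{(x,k,y): x,y\in\partial E,\ k\in\mathbb Z,\ x\sim_k y\}$, where $(x,k,y)$ has domain $y$ and codomain $x$, $(x,k,y)(y,l,z)=(x,k+l,z)$ and $(x,k,y)^{-1}=(y,-k,x)$. Its unit space is $\mathcal G_E^{(0)}=\{(x,0,x): x\in\partial E\}$. For $\alpha,\beta\in E^\star$ with $r(\alpha)=r(\beta)$ and $F\subseteq r(\alpha)E^1$ finite, put $$\mathcal Z(\alpha,\beta)=\{(\alpha x,|\alpha|-|\beta|,\beta x): x\in\partial E,\ s(x)=r(\alpha)\},\qquad \mathcal Z(\alpha,\beta,F)=\mathcal Z(\alpha,\beta)\setminus\bigcup_{e\in F}\mathcal Z(\alpha e,\beta e),$$ and give $\mathcal G_E$ the topology generated by all the sets $\mathcal Z(\alpha,\beta,F)$. An open bisection of a groupoid with a topology is an open set of morphisms on which the domain map and the codomain map each restrict to a homeomorphism onto an open subset of the unit space (with the subspace topology). An ample groupoid is a groupoid with a topology for which composition (on the set of composable pairs, with the subspace topology of the product) and inversion are continuous, whose unit space is Hausdorff, and which has a base of compact open bisections. **Theorem.** $\mathcal G_E$ is a Hausdorff ample groupoid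 (nonempty if $E^0\neq\emptyset$). The sets $\mathcal Z(\alpha,\beta,F)$ form a base of its topology, and each of them is a compact open bisection. Moreover, $x\mapsto(x,0,x)$ is a homeomorphism from $\partial E$ onto the unit space $\mathcal G_E^{(0)}$. -/

import Mathlib

open Set Topology TopologicalSpace

/-! ### Groupoids and topological groupoids -/

/-- A groupoid with set of morphisms `G` and set of units (objects) `X`, given by its domain,
codomain, composition, identity and inversion maps. The composite `g h` (written `m g h _`) is
defined exactly when `d g = c h`. This is a small category in which every morphism is invertible,
presented through the set of all of its morphisms, which is the set that carries the topology
of a topological groupoid. -/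
structure GroupoidOn (G : Type*) (X : Type*) where
  d : G → X
  c : G → X
  m : (g h : G) → d g = c h → G
  one : X → G
  i : G → G
  d_m : ∀ (g h : G) (w : d g = c h), d (m g h w) = d h
  c_m : ∀ (g h : G) (w : d g = c h), c (m g h w) = c g
  assoc : ∀ (g h k : G) (w : d g = c h) (w' : d h = c k),
    m (m g h w) k ((d_m g h w).trans w') = m g (m h k w') (w.trans (c_m h k w').symm)
  d_one : ∀ x, d (one x) = x
  c_one : ∀ x, c (one x) = x
  one_m : ∀ g, m (one (c g)) g (d_one (c g)) = g
  m_one : ∀ g, m g (one (d g)) (c_one (d g)).symm = g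
  d_i : ∀ g, d (i g) = c g
  c_i : ∀ g, c (i g) = d g
  i_m : ∀ g, m (i g) g (d_i g) = one (d g)
  m_i : ∀ g, m g (i g) (c_i g).symm = one (c g)
  i_i : ∀ g, i (i g) = g

namespace GroupoidOn

variable {G : Type*} {X : Type*} (𝒢 : GroupoidOn G X)

/-- The unit space, as a subset of the set of morphisms: a unit `x` is identified with the
identity morphism at `x`. It carries the subspace topology. -/
def unitSpace : Set G := range 𝒢.one

/-- The identification of the set of units with the unit space. -/
def toUnit (x : X) : 𝒢.unitSpace := ⟨𝒢.one x, mem_range_self x⟩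

/-- The domain map, with values in the unit space. -/
def dom (g : G) : 𝒢.unitSpace := 𝒢.toUnit (𝒢.d g)

/-- The codomain map, with values in the unit space. -/
def cod (g : G) : 𝒢.unitSpace := 𝒢.toUnit (𝒢.c g)

/-- The set of composable pairs. -/
def composable : Set (G × G) := {p | 𝒢.d p.1 = 𝒢.c p.2}

/-- Composition as a map on the set of composable pairs. -/
def comp (p : 𝒢.composable) : G := 𝒢.m p.1.1 p.1.2 p.2

/-- A topological groupoid: composition (on the composable pairs, with the subspace topology of
the product) and inversion are continuous. -/
structure IsTopological [TopologicalSpace G] : Prop where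
  continuous_comp : Continuous 𝒢.comp
  continuous_inv : Continuous 𝒢.i

/-- An open bisection: an open set of morphisms on which the codomain and the domain map restrict
to homeomorphisms onto open subsets of the unit space. -/
structure IsOpenBisection [TopologicalSpace G] (U : Set G) : Prop where
  isOpen : IsOpen U
  cod : IsOpenEmbedding (fun g : U => 𝒢.cod g)
  dom : IsOpenEmbedding (fun g : U => 𝒢.dom g)

/-- An ample groupoid: a topological groupoid with Hausdorff unit space and a base of compact
open bisections. -/
structure IsAmple [TopologicalSpace G] : Prop where
  isTopological : 𝒢.IsTopological
  t2Space_unitSpace : T2Space 𝒢.unitSpace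
  exists_basis : ∃ B : Set (Set G),
    IsTopologicalBasis B ∧ ∀ U ∈ B, IsCompact U ∧ 𝒢.IsOpenBisection U

end GroupoidOn

/-! ### Graphs and paths -/

/-- A directed graph with vertex set `V` and edge set `A`: every edge has a source and a range.
No countability or finiteness is assumed; loops and multiple edges are allowed. -/
structure DirectedGraph (V : Type*) (A : Type*) where
  s : A → V
  r : A → V

namespace DirectedGraph

variable {V : Type*} {A : Type*} (E : DirectedGraph V A)

/-- The set of edges emitted by `v`. -/
def outEdges (v : V) : Set A := {e | E.s e = v}

/-- A vertex is singular if it is a sink or an infinite emitter. -/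
def IsSingular (v : V) : Prop := E.outEdges v = ∅ ∨ (E.outEdges v).Infinite

/-- The list of edges is a (possibly empty) consecutive sequence of edges that starts at `v`. -/
def IsWalk : V → List A → Prop
  | _, [] => True
  | v, e :: l => E.s e = v ∧ IsWalk (E.r e) l

/-- The vertex where a walk from `v` ends. -/
def endpoint : V → List A → V
  | v, [] => v
  | _, e :: l => endpoint (E.r e) l

/-- The finite paths; the paths of length zero are the vertices. -/
@[ext]
structure FinitePath where
  src : V
  edges : List A
  isWalk : E.IsWalk src edges

/-- The infinite paths `p₁ p₂ p₃ …`, indexed from zero. -/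
@[ext]
structure InfinitePath where
  edges : ℕ → A
  isWalk : ∀ n, E.r (edges n) = E.s (edges (n + 1))

/-- The path space: all finite and all infinite paths. -/
inductive PathSpace
  | fin (α : E.FinitePath) : PathSpace
  | inf (p : E.InfinitePath) : PathSpace

variable {E}

theorem isWalk_append {v : V} {l l' : List A} (h : E.IsWalk v l)
    (h' : E.IsWalk (E.endpoint v l) l') : E.IsWalk v (l ++ l') := by
  induction l generalizing v with
  | nil => exact h'
  | cons e l ih => exact ⟨h.1, ih h.2 h'⟩

/-- The sequence that starts with the entries of a list and continues with a given sequence. -/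
def seqAppend : List A → (ℕ → A) → ℕ → A
  | [], p, n => p n
  | e :: _, _, 0 => e
  | _ :: l, p, n + 1 => seqAppend l p n

theorem s_seqAppend_zero {v : V} {l : List A} {p : ℕ → A} (h : E.IsWalk v l)
    (hp : E.endpoint v l = E.s (p 0)) : E.s (seqAppend l p 0) = v := by
  cases l with
  | nil => exact hp.symm
  | cons e l => exact h.1

theorem isWalk_seqAppend {v : V} {l : List A} {p : ℕ → A} (h : E.IsWalk v l)
    (hp : E.endpoint v l = E.s (p 0)) (hw : ∀ n, E.r (p n) = E.s (p (n + 1))) (n : ℕ) :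
    E.r (seqAppend l p n) = E.s (seqAppend l p (n + 1)) := by
  induction l generalizing v n with
  | nil => exact hw n
  | cons e l ih =>
    cases n with
    | zero => exact (s_seqAppend_zero h.2 hp).symm
    | succ n => exact ih h.2 hp n

namespace FinitePath

/-- The range of a finite path. -/
def range (α : E.FinitePath) : V := E.endpoint α.src α.edges

/-- The length of a finite path. -/
def length (α : E.FinitePath) : ℕ := α.edges.length

/-- Concatenation `α β` of finite paths. -/
def append (α β : E.FinitePath) (h : α.range = β.src) : E.FinitePath where
  src := α.src
  edges := α.edges ++ β.edges
  isWalk := isWalk_append α.isWalk (by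
    have h' : E.endpoint α.src α.edges = β.src := h
    rw [h']; exact β.isWalk)

/-- Concatenation `α p` of a finite and an infinite path. -/
def appendInf (α : E.FinitePath) (p : E.InfinitePath) (h : α.range = E.s (p.edges 0)) :
    E.InfinitePath where
  edges := seqAppend α.edges p.edges
  isWalk := isWalk_seqAppend α.isWalk h p.isWalk

/-- The path `α e`, for an edge `e` emitted by the range of `α`. -/
def snoc (α : E.FinitePath) (e : A) (h : e ∈ E.outEdges α.range) : E.FinitePath :=
  α.append ⟨E.s e, [e], rfl, trivial⟩ h.symm

/-- The one-sided shift on finite paths; it removes the first edge. (On a path of length zero,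
where the shift is not defined, the value is the path itself; it is never used.) -/
def shift : E.FinitePath → E.FinitePath
  | ⟨v, [], h⟩ => ⟨v, [], h⟩
  | ⟨_, e :: l, h⟩ => ⟨E.r e, l, h.2⟩

end FinitePath

namespace PathSpace

/-- The source of a path. -/
def src : E.PathSpace → V
  | fin α => α.src
  | inf p => E.s (p.edges 0)

/-- The length of a path. -/
def length : E.PathSpace → ℕ∞
  | fin α => α.length
  | inf _ => ⊤

/-- The one-sided shift `σ`, which removes the first edge of a path of positive length. -/
def shift : E.PathSpace → E.PathSpace
  | fin α => fin α.shift
  | inf p => inf ⟨fun n => p.edges (n + 1), fun n => p.isWalk (n + 1)⟩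

end PathSpace

/-- Concatenation `α x` of a finite path `α` with a finite or infinite path `x` that starts
where `α` ends. -/
def FinitePath.concat (α : E.FinitePath) : (x : E.PathSpace) → α.range = x.src → E.PathSpace
  | .fin β, h => .fin (α.append β h)
  | .inf p, h => .inf (α.appendInf p h)

/-- The cylinder set `C(α)` of all paths that extend `α`. -/
def cylinder (α : E.FinitePath) : Set E.PathSpace :=
  {y | ∃ (x : E.PathSpace) (h : α.range = x.src), α.concat x h = y}

/-- The generalised cylinder set `C(α, F) = C(α) \ ⋃_{e ∈ F} C(α e)`, for a set `F` of edges
emitted by the range of `α`. -/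
def genCylinder (α : E.FinitePath) (F : Set A) : Set E.PathSpace :=
  cylinder α \ ⋃ (e : A) (_ : e ∈ F) (h : e ∈ E.outEdges α.range), cylinder (α.snoc e h)

/-- The topology of the path space is generated by the generalised cylinder sets `C(α, F)` with
`F` a finite set of edges emitted by the range of `α`. -/
instance : TopologicalSpace E.PathSpace :=
  generateFrom {U | ∃ (α : E.FinitePath) (F : Set A),
    F.Finite ∧ F ⊆ E.outEdges α.range ∧ U = genCylinder α F}

variable (E)

/-- The boundary paths: the infinite paths and the finite paths that end at a singular vertex. -/
def boundary : Set E.PathSpace :=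
  {x | match x with
    | .fin α => E.IsSingular α.range
    | .inf _ => True}

/-- The boundary path space `∂E`, with the subspace topology of the path space. -/
abbrev BoundaryPath : Type _ := E.boundary

variable {E}

/-! ### The boundary path groupoid -/

/-- Tail equivalence with lag `k`: `σⁿ(x) = σⁿ⁻ᵏ(y)` for some `n ≥ max {0, k}` for which both
sides are defined (`m` is `n - k`, and `σⁿ` is defined on the paths of length at least `n`). -/
def TailEquiv (k : ℤ) (x y : E.PathSpace) : Prop :=
  ∃ n m : ℕ, (m : ℤ) = n - k ∧ (n : ℕ∞) ≤ x.length ∧ (m : ℕ∞) ≤ y.length ∧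
    PathSpace.shift^[n] x = PathSpace.shift^[m] y

theorem PathSpace.length_shift (x : E.PathSpace) : x.shift.length = x.length - 1 := by
  rcases x with ⟨v, _ | ⟨e, l⟩, h⟩ | p
  · simp [shift, length, FinitePath.shift, FinitePath.length]
  · change ((l.length : ℕ) : ℕ∞) = ((l.length + 1 : ℕ) : ℕ∞) - 1
    norm_cast
  · simp [shift, length]

theorem PathSpace.length_shift_iterate (x : E.PathSpace) (n : ℕ) :
    (shift^[n] x).length = x.length - n := by
  induction n with
  | zero => simp
  | succ n ih =>
    rw [Function.iterate_succ_apply', length_shift, ih, tsub_tsub]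
    simp

theorem TailEquiv.refl (x : E.PathSpace) : TailEquiv 0 x x := ⟨0, 0, by simp⟩

theorem TailEquiv.symm {k : ℤ} {x y : E.PathSpace} (h : TailEquiv k x y) :
    TailEquiv (-k) y x := by
  obtain ⟨n, m, h1, h2, h3, h4⟩ := h
  exact ⟨m, n, by omega, h3, h2, h4.symm⟩

theorem TailEquiv.extend {x y : E.PathSpace} {n m : ℕ} (hn : (n : ℕ∞) ≤ x.length)
    (h : PathSpace.shift^[n] x = PathSpace.shift^[m] y) (j : ℕ)
    (hj : ((m + j : ℕ) : ℕ∞) ≤ y.length) :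
    ((n + j : ℕ) : ℕ∞) ≤ x.length ∧
      PathSpace.shift^[n + j] x = PathSpace.shift^[m + j] y := by
  constructor
  · have hl := congrArg PathSpace.length h
    rw [PathSpace.length_shift_iterate, PathSpace.length_shift_iterate] at hl
    have h1 : (j : ℕ∞) ≤ y.length - m := by
      apply ENat.le_sub_of_add_le_left (ENat.natCast_ne_top m)
      exact_mod_cast hj
    rw [← hl] at h1
    calc ((n + j : ℕ) : ℕ∞) = n + j := by push_cast; rfl
      _ ≤ n + (x.length - n) := by gcongr
      _ = x.length := add_tsub_cancel_of_le hn
  · rw [add_comm n, add_comm m, Function.iterate_add_apply, Function.iterate_add_apply, h]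

theorem TailEquiv.trans {k l : ℤ} {x y z : E.PathSpace} (h : TailEquiv k x y)
    (h' : TailEquiv l y z) : TailEquiv (k + l) x z := by
  obtain ⟨n, m, h1, h2, h3, h4⟩ := h
  obtain ⟨n', m', h1', h2', h3', h4'⟩ := h'
  rcases le_total m n' with hle | hle
  · obtain ⟨j, rfl⟩ := Nat.exists_eq_add_of_le hle
    obtain ⟨ha, hb⟩ := TailEquiv.extend h2 h4 j h2'
    exact ⟨n + j, m', by push_cast at *; omega, ha, h3', hb.trans h4'⟩
  · obtain ⟨j, rfl⟩ := Nat.exists_eq_add_of_le hle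
    obtain ⟨ha, hb⟩ := TailEquiv.extend h3' h4'.symm j h3
    exact ⟨n, m' + j, by push_cast at *; omega, h2, ha, h4.trans hb.symm⟩

variable (E)

/-- The set of morphisms of the boundary path groupoid: the triples `(x, k, y)` of boundary paths
`x`, `y` and an integer `k` such that `x` and `y` are tail equivalent with lag `k`. -/
@[ext]
structure BoundaryMorphism where
  left : E.BoundaryPath
  lag : ℤ
  right : E.BoundaryPath
  tailEquiv : TailEquiv lag left.1 right.1

/-- The boundary path groupoid `𝒢_E`: `(x, k, y)` has domain `y` and codomain `x`, and
`(x, k, y) (y, l, z) = (x, k + l, z)`, `(x, k, y)⁻¹ = (y, -k, x)`. -/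
def boundaryPathGroupoid : GroupoidOn E.BoundaryMorphism E.BoundaryPath where
  d g := g.right
  c g := g.left
  m g h w := ⟨g.left, g.lag + h.lag, h.right, g.tailEquiv.trans (w ▸ h.tailEquiv)⟩
  one x := ⟨x, 0, x, .refl x.1⟩
  i g := ⟨g.right, -g.lag, g.left, g.tailEquiv.symm⟩
  d_m _ _ _ := rfl
  c_m _ _ _ := rfl
  assoc g h k _ _ := by ext1 <;> simp [add_assoc]
  d_one _ := rfl
  c_one _ := rfl
  one_m g := by ext1 <;> simp
  m_one g := by ext1 <;> simp
  d_i _ := rfl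
  c_i _ := rfl
  i_m g := by ext1 <;> simp
  m_i g := by ext1 <;> simp
  i_i g := by ext1 <;> simp

variable {E}

/-- The set `Z(α, β) = {(α x, |α| - |β|, β x) | x ∈ ∂E, s(x) = r(α)}`, for finite paths
`α`, `β` with `r(α) = r(β)`. -/
def bisection (α β : E.FinitePath) : Set E.BoundaryMorphism :=
  {g | ∃ (x : E.BoundaryPath) (hα : α.range = x.1.src) (hβ : β.range = x.1.src),
    g.left.1 = α.concat x.1 hα ∧ g.lag = (α.length : ℤ) - β.length ∧
      g.right.1 = β.concat x.1 hβ}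

/-- The set `Z(α, β, F) = Z(α, β) \ ⋃_{e ∈ F} Z(α e, β e)`, for finite paths `α`, `β` with
`r(α) = r(β)` and a set `F` of edges emitted by this vertex. -/
def genBisection (α β : E.FinitePath) (F : Set A) : Set E.BoundaryMorphism :=
  bisection α β \ ⋃ (e : A) (_ : e ∈ F) (hα : e ∈ E.outEdges α.range)
    (hβ : e ∈ E.outEdges β.range), bisection (α.snoc e hα) (β.snoc e hβ)

variable (E)

/-- The collection of all sets `Z(α, β, F)`, where `α`, `β` are finite paths with
`r(α) = r(β)` and `F` is a finite set of edges emitted by `r(α)`. -/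
def basicBisections : Set (Set E.BoundaryMorphism) :=
  {U | ∃ (α β : E.FinitePath) (F : Set A), α.range = β.range ∧ F.Finite ∧
    F ⊆ E.outEdges α.range ∧ U = genBisection α β F}

/-- The topology of the boundary path groupoid is generated by the sets `Z(α, β, F)`. -/
instance : TopologicalSpace E.BoundaryMorphism := generateFrom E.basicBisections

end DirectedGraph

/-! Everything is read off from the codomain coordinate. On `bisection α β` a morphism is determined
by its left end, since `(α x, |α| - |β|, β x)` is known once `α x` is (`eq_of_left_eq`), and every
boundary path in `C(α)` occurs as a left end (`exists_left_eq`). Under this bijection `Z(α, β, F)`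
corresponds to `C(α, F) ∩ ∂E` (`mem_genBisection`, `left_image_genBisection`). Inversion exchanges
`α` and `β`, so facts about the codomain pass to the domain.

The base property comes from the tree structure of paths: cylinder sets with a common point are
nested, and `Z(α, β)` can be shrunk around `g` to `Z(α η, β η)` for any initial segment `α η` of the
left end of `g` (`exists_bisection_subset`). Hence the codomain map is continuous, open and
injective on each `Z(α, β, F)`, whose compactness reduces to that of `C(α, F) ∩ ∂E`.

For the latter, the paths whose cylinder sets belong to a given ultrafilter are the initial segments
of one path, and this path is the limit. It cannot be a finite path ending at a regular vertex,
because there excluding all emitted edges isolates it.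

The Hausdorff property holds because `(x, k, y)` depends injectively and continuously on its three
entries. A product of elements of `Z(α, β)` and `Z(β, γ)` lies in `Z(α, γ)` and keeps the left end
of the first factor, so composition is continuous because the codomain map is continuous and open.
-/

namespace DirectedGraph

variable {V : Type*} {A : Type*} {E : DirectedGraph V A}

/-! ### Concatenation of paths -/

namespace PathSpace

/-- The edge of a path at a given position, if there is one. -/
def edge? : E.PathSpace → ℕ → Option A
  | fin α, n => α.edges[n]?
  | inf p, n => some (p.edges n)

theorem ext_edge? {x y : E.PathSpace} (hs : x.src = y.src) (he : ∀ n, x.edge? n = y.edge? n) :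
    x = y := by
  rcases x with α | p <;> rcases y with β | q
  · exact congrArg fin (FinitePath.ext hs (List.ext_getElem? he))
  · have h := he α.edges.length
    simp [edge?] at h
  · have h := he β.edges.length
    simp [edge?] at h
  · exact congrArg inf (InfinitePath.ext (funext fun n => Option.some_injective _ (he n)))

theorem src_concat {α : E.FinitePath} {x : E.PathSpace} (h : α.range = x.src) :
    (α.concat x h).src = α.src := by
  rcases x with β | p
  · rfl
  · exact s_seqAppend_zero α.isWalk h

theorem length_concat {α : E.FinitePath} {x : E.PathSpace} (h : α.range = x.src) :
    (α.concat x h).length = α.length + x.length := by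
  rcases x with β | p
  · simp [FinitePath.concat, length, FinitePath.length, FinitePath.append]
  · simp [FinitePath.concat, length]

theorem some_seqAppend (l : List A) (p : ℕ → A) (n : ℕ) :
    some (seqAppend l p n) = if n < l.length then l[n]? else some (p (n - l.length)) := by
  induction l generalizing n with
  | nil => simp [seqAppend]
  | cons e l ih =>
    cases n with
    | zero => simp [seqAppend]
    | succ n => simp [seqAppend, ih]

theorem edge?_concat {α : E.FinitePath} {x : E.PathSpace} (h : α.range = x.src) (n : ℕ) :
    (α.concat x h).edge? n =
      if n < α.length then α.edges[n]? else x.edge? (n - α.length) := by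
  rcases x with β | p
  · exact List.getElem?_append
  · exact some_seqAppend _ _ _

theorem shift_iterate_concat {α : E.FinitePath} {x : E.PathSpace} (h : α.range = x.src) :
    shift^[α.length] (α.concat x h) = x := by
  obtain ⟨v, l, hl⟩ := α
  induction l generalizing v with
  | nil =>
    rcases x with β | p
    · exact congrArg fin (FinitePath.ext h rfl)
    · rfl
  | cons e l ih =>
    have := ih (E.r e) hl.2 h
    rcases x with β | p <;> exact this

theorem edge?_isSome_iff {x : E.PathSpace} {n : ℕ} :
    (x.edge? n).isSome ↔ ((n + 1 : ℕ) : ℕ∞) ≤ x.length := by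
  rcases x with α | p
  · change (α.edges[n]?).isSome ↔ ((n + 1 : ℕ) : ℕ∞) ≤ (α.edges.length : ℕ∞)
    rw [Nat.cast_le]
    simp [Order.add_one_le_iff]
  · simp [edge?, length]

theorem src_eq_of_edge?_zero {x : E.PathSpace} {e : A} (h : x.edge? 0 = some e) :
    E.s e = x.src := by
  rcases x with ⟨v, _ | ⟨f, l⟩, hl⟩ | p
  · simp [edge?] at h
  · obtain rfl : f = e := by simpa [edge?] using h
    exact hl.1
  · obtain rfl : p.edges 0 = e := by simpa [edge?] using h
    rfl

theorem edge?_shift (x : E.PathSpace) (n : ℕ) : x.shift.edge? n = x.edge? (n + 1) := by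
  rcases x with ⟨v, _ | ⟨f, l⟩, hl⟩ | p <;> simp [edge?, shift, FinitePath.shift]

theorem src_shift_of_edge?_zero {x : E.PathSpace} {e : A} (h : x.edge? 0 = some e) :
    E.r e = x.shift.src := by
  rcases x with ⟨v, _ | ⟨f, l⟩, hl⟩ | p
  · simp [edge?] at h
  · obtain rfl : f = e := by simpa [edge?] using h
    rfl
  · obtain rfl : p.edges 0 = e := by simpa [edge?] using h
    exact p.isWalk 0

theorem r_eq_s_of_edge? {x : E.PathSpace} {n : ℕ} {e f : A} (he : x.edge? n = some e)
    (hf : x.edge? (n + 1) = some f) : E.r e = E.s f := by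
  induction n generalizing x with
  | zero =>
    rw [src_shift_of_edge?_zero he, src_eq_of_edge?_zero ((edge?_shift x 0).trans hf)]
  | succ n ih => exact ih ((edge?_shift x n).trans he) ((edge?_shift x (n + 1)).trans hf)

end PathSpace

namespace FinitePath

/-- The path of length zero at a vertex. -/
def vertex (v : V) : E.FinitePath := ⟨v, [], trivial⟩

/-- The path of length one given by an edge. -/
def single (e : A) : E.FinitePath := ⟨E.s e, [e], rfl, trivial⟩

theorem endpoint_append (v : V) (l l' : List A) :
    E.endpoint v (l ++ l') = E.endpoint (E.endpoint v l) l' := by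
  induction l generalizing v with
  | nil => rfl
  | cons e l ih => exact ih (E.r e)

theorem range_append {α β : E.FinitePath} (h : α.range = β.src) :
    (α.append β h).range = β.range := by
  refine (endpoint_append _ _ _).trans ?_
  change E.endpoint α.range _ = _
  rw [h]; rfl

theorem length_append {α β : E.FinitePath} (h : α.range = β.src) :
    (α.append β h).length = α.length + β.length := List.length_append

theorem length_snoc {α : E.FinitePath} {e : A} (h : e ∈ E.outEdges α.range) :
    (α.snoc e h).length = α.length + 1 := length_append h.symm

theorem seqAppend_append (l l' : List A) (p : ℕ → A) :
    seqAppend (l ++ l') p = seqAppend l (seqAppend l' p) := by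
  induction l with
  | nil => rfl
  | cons e l ih => funext n; cases n <;> simp [seqAppend, ih]

theorem concat_append {α β : E.FinitePath} {x : E.PathSpace} (h : α.range = β.src)
    (hx : β.range = x.src) :
    (α.append β h).concat x ((range_append h).trans hx) =
      α.concat (β.concat x hx) (h.trans (PathSpace.src_concat hx).symm) := by
  rcases x with γ | p
  · exact congrArg PathSpace.fin (FinitePath.ext rfl (List.append_assoc _ _ _))
  · exact congrArg PathSpace.inf (InfinitePath.ext (seqAppend_append _ _ _))

theorem concat_vertex {v : V} {x : E.PathSpace} (h : (vertex v : E.FinitePath).range = x.src) :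
    (vertex v : E.FinitePath).concat x h = x := PathSpace.shift_iterate_concat (α := vertex v) h

theorem concat_right_injective {α : E.FinitePath} {x y : E.PathSpace} {hx : α.range = x.src}
    {hy : α.range = y.src} (h : α.concat x hx = α.concat y hy) : x = y := by
  rw [← PathSpace.shift_iterate_concat hx, h, PathSpace.shift_iterate_concat]

theorem eq_of_concat_eq {α β : E.FinitePath} {x y : E.PathSpace} {hx : α.range = x.src}
    {hy : β.range = y.src} (h : α.concat x hx = β.concat y hy) (hl : α.length = β.length) :
    α = β := by
  refine FinitePath.ext ?_ (List.ext_getElem? fun n => ?_)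
  · rw [← PathSpace.src_concat hx, h, PathSpace.src_concat]
  · have h' := congrArg (PathSpace.edge? · n) h
    simp only [PathSpace.edge?_concat, hl] at h'
    split_ifs at h' with hn
    · exact h'
    · rw [List.getElem?_eq_none (hl.trans_le (not_lt.1 hn)), List.getElem?_eq_none (not_lt.1 hn)]

end FinitePath

/-! ### Initial segments of paths -/

open FinitePath

theorem PathSpace.exists_single_concat {x : E.PathSpace} (h : 1 ≤ x.length) :
    ∃ (e : A) (he : (single e : E.FinitePath).range = x.shift.src),
      (single e).concat x.shift he = x := by
  have h0 : (x.edge? 0).isSome := edge?_isSome_iff.2 (by simpa using h)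
  obtain ⟨e, he⟩ := Option.isSome_iff_exists.1 h0
  have hr : (single e : E.FinitePath).range = x.shift.src := src_shift_of_edge?_zero he
  refine ⟨e, hr, ext_edge? ?_ fun n => ?_⟩
  · rw [src_concat, ← src_eq_of_edge?_zero he]; rfl
  · rw [edge?_concat]
    cases n with
    | zero => simp [single, FinitePath.length, he]
    | succ n => simp [single, FinitePath.length, edge?_shift]

theorem PathSpace.exists_concat {x : E.PathSpace} {n : ℕ} (h : (n : ℕ∞) ≤ x.length) :
    ∃ (α : E.FinitePath) (y : E.PathSpace) (hy : α.range = y.src),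
      α.length = n ∧ α.concat y hy = x := by
  induction n generalizing x with
  | zero => exact ⟨vertex x.src, x, rfl, rfl, concat_vertex rfl⟩
  | succ n ih =>
    push_cast at h
    obtain ⟨e, he, hx⟩ := exists_single_concat (le_add_self.trans h)
    have h' : (n : ℕ∞) ≤ x.shift.length := by
      rw [length_shift]
      exact ENat.le_sub_of_add_le_right ENat.one_ne_top h
    obtain ⟨α, y, hy, hl, hxy⟩ := ih h'
    have hα : (single e : E.FinitePath).range = α.src := by
      rw [he, ← hxy, src_concat]
    refine ⟨(single e).append α hα, y, (range_append hα).trans hy, ?_, ?_⟩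
    · rw [length_append, hl, add_comm]; rfl
    · rw [concat_append hα hy]
      simp only [hxy, hx]

/-- Cut `γ` after `|α|` edges: two initial segments of one path with equal length coincide, and what
follows `α` can be cancelled. -/
theorem FinitePath.exists_eq_append {α γ : E.FinitePath} {x y : E.PathSpace}
    {hx : α.range = x.src} {hy : γ.range = y.src} (h : α.concat x hx = γ.concat y hy)
    (hl : α.length ≤ γ.length) :
    ∃ (η : E.FinitePath) (hη : α.range = η.src) (hηy : η.range = y.src),
      γ = α.append η hη ∧ x = η.concat y hηy := by
  obtain ⟨α', z, hz, hl', hγ⟩ := PathSpace.exists_concat (x := .fin γ) (n := α.length)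
    (Nat.cast_le.2 hl)
  rcases z with η | p
  swap; · cases hγ
  obtain rfl : α'.append η hz = γ := by injection hγ
  have hηy : η.range = y.src := (range_append hz).symm.trans hy
  rw [concat_append (h := hz) (hx := hηy)] at h
  obtain rfl := eq_of_concat_eq h hl'.symm
  exact ⟨η, hz, hηy, rfl, concat_right_injective h⟩

/-! ### Cylinder sets -/

theorem self_mem_cylinder (α : E.FinitePath) : PathSpace.fin α ∈ cylinder α := by
  refine ⟨.fin (vertex α.range), rfl, ?_⟩
  exact congrArg PathSpace.fin (FinitePath.ext rfl (List.append_nil _))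

theorem concat_mem_cylinder {α : E.FinitePath} {x : E.PathSpace} (h : α.range = x.src) :
    α.concat x h ∈ cylinder α := ⟨x, h, rfl⟩

theorem mem_cylinder_vertex {v : V} {x : E.PathSpace} :
    x ∈ cylinder (vertex v : E.FinitePath) ↔ x.src = v := by
  constructor
  · rintro ⟨y, hy, rfl⟩
    exact PathSpace.src_concat hy
  · rintro rfl
    exact ⟨x, rfl, concat_vertex rfl⟩

theorem length_le_of_mem_cylinder {α : E.FinitePath} {x : E.PathSpace} (h : x ∈ cylinder α) :
    (α.length : ℕ∞) ≤ x.length := by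
  obtain ⟨y, hy, rfl⟩ := h
  rw [PathSpace.length_concat]
  exact le_self_add

theorem src_of_mem_cylinder {α : E.FinitePath} {x : E.PathSpace} (h : x ∈ cylinder α) :
    x.src = α.src := by
  obtain ⟨y, hy, rfl⟩ := h
  exact PathSpace.src_concat hy

theorem edge?_of_mem_cylinder {α : E.FinitePath} {x : E.PathSpace} (h : x ∈ cylinder α) {n : ℕ}
    (hn : n < α.length) : x.edge? n = α.edges[n]? := by
  obtain ⟨y, hy, rfl⟩ := h
  rw [PathSpace.edge?_concat, if_pos hn]

theorem exists_mem_cylinder {x : E.PathSpace} {n : ℕ} (h : (n : ℕ∞) ≤ x.length) :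
    ∃ α : E.FinitePath, α.length = n ∧ x ∈ cylinder α := by
  obtain ⟨α, y, hy, hl, rfl⟩ := PathSpace.exists_concat h
  exact ⟨α, hl, concat_mem_cylinder hy⟩

theorem eq_of_mem_cylinder {α γ : E.FinitePath} {x : E.PathSpace} (hα : x ∈ cylinder α)
    (hγ : x ∈ cylinder γ) (hl : α.length = γ.length) : α = γ := by
  obtain ⟨y, hy, rfl⟩ := hα
  obtain ⟨z, hz, h⟩ := hγ
  exact eq_of_concat_eq h.symm hl

theorem cylinder_append_subset {α η : E.FinitePath} (h : α.range = η.src) :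
    cylinder (α.append η h) ⊆ cylinder α := by
  rintro _ ⟨y, hy, rfl⟩
  rw [concat_append (h := h) (hx := (range_append h).symm.trans hy)]
  exact concat_mem_cylinder _

/-- Both paths are initial segments of `x`, so the longer one extends the shorter. -/
theorem cylinder_subset_cylinder {α γ : E.FinitePath} {x : E.PathSpace} (hα : x ∈ cylinder α)
    (hγ : x ∈ cylinder γ) (hl : α.length ≤ γ.length) : cylinder γ ⊆ cylinder α := by
  obtain ⟨y, hy, rfl⟩ := hα
  obtain ⟨z, hz, h⟩ := hγ
  obtain ⟨η, hη, hηz, rfl, rfl⟩ := exists_eq_append h.symm hl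
  exact cylinder_append_subset hη

theorem mem_cylinder_iff {α : E.FinitePath} {x : E.PathSpace} :
    x ∈ cylinder α ↔ x.src = α.src ∧ ∀ n < α.length, x.edge? n = α.edges[n]? := by
  refine ⟨fun h => ⟨src_of_mem_cylinder h, fun n hn => edge?_of_mem_cylinder h hn⟩, ?_⟩
  rintro ⟨hs, he⟩
  have hl : (α.length : ℕ∞) ≤ x.length := by
    rcases hα : α.length with _ | n
    · simp
    · refine PathSpace.edge?_isSome_iff.1 ?_
      rw [he n (by omega)]
      simpa using show n < α.edges.length from n.lt_succ_self.trans_eq hα.symm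
  obtain ⟨β, hβ, hx⟩ := exists_mem_cylinder hl
  obtain rfl : α = β := by
    refine FinitePath.ext (hs.symm.trans (src_of_mem_cylinder hx)) (List.ext_getElem? fun n => ?_)
    rcases lt_or_ge n α.length with hn | hn
    · rw [← he n hn, edge?_of_mem_cylinder hx (hn.trans_eq hβ.symm)]
    · rw [List.getElem?_eq_none hn, List.getElem?_eq_none (hβ.trans_le hn)]
  exact hx

theorem mem_cylinder_snoc {α : E.FinitePath} {e : A} (h : e ∈ E.outEdges α.range)
    {x : E.PathSpace} :
    x ∈ cylinder (α.snoc e h) ↔ x ∈ cylinder α ∧ x.edge? α.length = some e := by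
  have hedge : ∀ n, (α.snoc e h).edges[n]? = if n < α.length then α.edges[n]? else
      [e][n - α.length]? := fun n => List.getElem?_append
  have hsrc : (α.snoc e h).src = α.src := rfl
  rw [mem_cylinder_iff, mem_cylinder_iff, length_snoc, hsrc]
  constructor
  · rintro ⟨hs, he⟩
    refine ⟨⟨hs, fun n hn => ?_⟩, ?_⟩
    · rw [he n (by omega), hedge, if_pos hn]
    · rw [he _ (by omega), hedge]; simp
  · rintro ⟨⟨hs, he⟩, he'⟩
    refine ⟨hs, fun n hn => ?_⟩
    rw [hedge]
    split_ifs with h1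
    · exact he n h1
    · obtain rfl : n = α.length := by omega
      simp [he']

theorem mem_genCylinder {α : E.FinitePath} {F : Set A} (hF : F ⊆ E.outEdges α.range)
    {x : E.PathSpace} :
    x ∈ genCylinder α F ↔ x ∈ cylinder α ∧ ∀ e ∈ F, x.edge? α.length ≠ some e := by
  simp only [genCylinder, mem_sdiff, mem_iUnion, mem_cylinder_snoc, not_exists, not_and]
  exact ⟨fun h => ⟨h.1, fun e he => h.2 e he (hF he) h.1⟩,
    fun h => ⟨h.1, fun e he _ _ => h.2 e he⟩⟩

theorem genCylinder_subset (α : E.FinitePath) (F : Set A) : genCylinder α F ⊆ cylinder α :=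
  sdiff_subset

theorem genCylinder_empty (α : E.FinitePath) : genCylinder α ∅ = cylinder α := by
  simp [genCylinder]

/-- Two generalised cylinder sets with a common point have an intersection of the same form. -/
theorem exists_genCylinder_subset_inter {α γ : E.FinitePath} {F H : Set A}
    (hF : F.Finite) (hF' : F ⊆ E.outEdges α.range) (hH : H.Finite)
    (hH' : H ⊆ E.outEdges γ.range) {x : E.PathSpace} (hα : x ∈ genCylinder α F)
    (hγ : x ∈ genCylinder γ H) (hl : α.length ≤ γ.length) :
    ∃ K : Set A, K.Finite ∧ K ⊆ E.outEdges γ.range ∧ x ∈ genCylinder γ K ∧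
      genCylinder γ K ⊆ genCylinder α F ∧ genCylinder γ K ⊆ genCylinder γ H := by
  have hsub := cylinder_subset_cylinder hα.1 hγ.1 hl
  rw [mem_genCylinder hF'] at hα
  rw [mem_genCylinder hH'] at hγ
  rcases hl.eq_or_lt with hl | hl
  · obtain rfl := eq_of_mem_cylinder hα.1 hγ.1 hl
    have hU := union_subset hF' hH'
    refine ⟨F ∪ H, hF.union hH, hU, ?_, ?_, ?_⟩
    · exact (mem_genCylinder hU).2 ⟨hα.1, fun e he => he.elim (hα.2 e) (hγ.2 e)⟩
    · intro y hy
      rw [mem_genCylinder hU] at hy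
      exact (mem_genCylinder hF').2 ⟨hy.1, fun e he => hy.2 e (.inl he)⟩
    · intro y hy
      rw [mem_genCylinder hU] at hy
      exact (mem_genCylinder hH').2 ⟨hy.1, fun e he => hy.2 e (.inr he)⟩
  -- The condition from `F` concerns the edge at position `|α| < |γ|`. This edge is the same for all
  -- paths in `C(γ)`, and `x` satisfies the condition.
  · refine ⟨H, hH, hH', (mem_genCylinder hH').2 hγ, fun y hy => ?_, Subset.rfl⟩
    refine (mem_genCylinder hF').2 ⟨hsub hy.1, fun e he => ?_⟩
    rw [edge?_of_mem_cylinder hy.1 hl, ← edge?_of_mem_cylinder hγ.1 hl]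
    exact hα.2 e he

/-! ### Separation of paths by clopen cylinder sets -/

theorem PathSpace.ext_cylinder {x y : E.PathSpace}
    (h : ∀ γ : E.FinitePath, x ∈ cylinder γ ↔ y ∈ cylinder γ) : x = y := by
  have key : ∀ {x y : E.PathSpace}, (∀ γ : E.FinitePath, x ∈ cylinder γ ↔ y ∈ cylinder γ) →
      ∀ n e, x.edge? n = some e → y.edge? n = some e := by
    intro x y h n e he
    obtain ⟨γ, hl, hγ⟩ := exists_mem_cylinder (x := x) (n := n + 1)
      (edge?_isSome_iff.1 (by simp [he]))
    rw [edge?_of_mem_cylinder ((h γ).1 hγ) (by omega), ← edge?_of_mem_cylinder hγ (by omega), he]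
  refine ext_edge? ?_ fun n => Option.ext fun e =>
    ⟨key h n e, key (fun γ => (h γ).symm) n e⟩
  exact (mem_cylinder_vertex.1 ((h _).1 (mem_cylinder_vertex.2 rfl))).symm

theorem isOpen_genCylinder {α : E.FinitePath} {F : Set A} (hF : F.Finite)
    (hF' : F ⊆ E.outEdges α.range) : IsOpen (genCylinder α F) :=
  .basic _ ⟨α, F, hF, hF', rfl⟩

theorem isOpen_cylinder (α : E.FinitePath) : IsOpen (cylinder α) :=
  genCylinder_empty α ▸ isOpen_genCylinder finite_empty (empty_subset _)

theorem FinitePath.eq_snoc {v : V} {l : List A} {e : A} (h : E.IsWalk v (l ++ [e])) :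
    ∃ (hl : E.IsWalk v l) (he : e ∈ E.outEdges (FinitePath.mk v l hl).range),
      FinitePath.mk v (l ++ [e]) h = (FinitePath.mk v l hl).snoc e he := by
  obtain ⟨α, z, hz, hl, hα⟩ := PathSpace.exists_concat (x := .fin ⟨v, l ++ [e], h⟩)
    (n := l.length) (Nat.cast_le.2 (by simp [FinitePath.length]))
  rcases z with β | p
  swap; · cases hα
  obtain ⟨u, a, ha⟩ := α
  obtain ⟨w, b, hb⟩ := β
  have h1 : FinitePath.append ⟨u, a, ha⟩ ⟨w, b, hb⟩ hz = ⟨v, l ++ [e], h⟩ := by injection hα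
  have h2 : a ++ b = l ++ [e] := congrArg FinitePath.edges h1
  obtain rfl : u = v := congrArg FinitePath.src h1
  obtain ⟨rfl, rfl⟩ := List.append_inj h2 hl
  exact ⟨ha, hb.1.trans hz.symm, rfl⟩

/-- Induction on the last edge: a path outside `C(α e)` is either outside `C(α)` or in `C(α, {e})`.
For a vertex, the complement consists of the paths with another source. -/
theorem isOpen_compl_cylinder (α : E.FinitePath) : IsOpen (cylinder α)ᶜ := by
  obtain ⟨v, l, hl⟩ := α
  induction l using List.reverseRecOn with
  | nil =>
    have : (cylinder (⟨v, [], hl⟩ : E.FinitePath))ᶜ =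
        ⋃ (w : V) (_ : w ≠ v), cylinder (vertex w : E.FinitePath) := by
      ext x
      simp only [mem_compl_iff, mem_iUnion, mem_cylinder_vertex, exists_prop, exists_eq_right']
      exact not_congr mem_cylinder_vertex
    rw [this]
    exact isOpen_iUnion fun w => isOpen_iUnion fun _ => isOpen_cylinder _
  | append_singleton l e ih =>
    obtain ⟨hl', he, h⟩ := FinitePath.eq_snoc hl
    rw [h]
    have hF : ({e} : Set A) ⊆ E.outEdges (FinitePath.mk v l hl').range := singleton_subset_iff.2 he
    have : (cylinder ((⟨v, l, hl'⟩ : E.FinitePath).snoc e he))ᶜ =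
        (cylinder (⟨v, l, hl'⟩ : E.FinitePath))ᶜ ∪ genCylinder ⟨v, l, hl'⟩ {e} := by
      ext x
      rw [mem_compl_iff, mem_cylinder_snoc, mem_union, mem_genCylinder hF, mem_compl_iff]
      simp only [mem_singleton_iff, forall_eq, ne_eq]
      tauto
    rw [this]
    exact (ih hl').union (isOpen_genCylinder (finite_singleton e) hF)

instance : T2Space E.PathSpace := by
  refine ⟨fun x y hxy => ?_⟩
  obtain ⟨γ, hγ⟩ := not_forall.1 (mt PathSpace.ext_cylinder hxy)
  by_cases hx : x ∈ cylinder γ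
  · exact ⟨_, _, isOpen_cylinder γ, isOpen_compl_cylinder γ, hx, by tauto,
      disjoint_compl_right⟩
  · exact ⟨_, _, isOpen_compl_cylinder γ, isOpen_cylinder γ, hx, by tauto,
      disjoint_compl_left⟩

/-! ### Compactness -/

/-- An ultrafilter that contains a cylinder set has a limit, described by cylinder sets. -/
theorem exists_forall_mem_cylinder_iff (𝒰 : Ultrafilter E.PathSpace) {α : E.FinitePath}
    (hα : cylinder α ∈ 𝒰) : ∃ x : E.PathSpace, ∀ γ, x ∈ cylinder γ ↔ cylinder γ ∈ 𝒰 := by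
  have hne : ∀ {γ δ : E.FinitePath}, cylinder γ ∈ 𝒰 → cylinder δ ∈ 𝒰 →
      ∃ z, z ∈ cylinder γ ∧ z ∈ cylinder δ := fun h h' =>
    𝒰.nonempty_of_mem (Filter.inter_mem h h')
  -- If the lengths are bounded, a longest path with cylinder set in `𝒰` is the limit; otherwise
  -- these paths fit together to an infinite path.
  by_cases hb : ∃ N, ∀ γ : E.FinitePath, cylinder γ ∈ 𝒰 → γ.length ≤ N
  · classical
    obtain ⟨N, hN⟩ := hb
    obtain ⟨n, ⟨γ, hγ, rfl⟩, hmax⟩ : ∃ n, (∃ γ : E.FinitePath, cylinder γ ∈ 𝒰 ∧ γ.length = n) ∧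
        ∀ m, (∃ γ : E.FinitePath, cylinder γ ∈ 𝒰 ∧ γ.length = m) → m ≤ n := by
      have hP : ∃ γ : E.FinitePath, cylinder γ ∈ 𝒰 ∧ γ.length = α.length := ⟨α, hα, rfl⟩
      refine ⟨_, Nat.findGreatest_spec (P := fun n => ∃ γ : E.FinitePath, cylinder γ ∈ 𝒰 ∧
        γ.length = n) (hN α hα) hP, fun m hm => ?_⟩
      refine Nat.le_findGreatest ?_ hm
      obtain ⟨δ, hδ, rfl⟩ := hm
      exact hN δ hδ
    refine ⟨.fin γ, fun δ => ⟨fun h => ?_, fun h => ?_⟩⟩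
    · exact Filter.mem_of_superset hγ (cylinder_subset_cylinder h (self_mem_cylinder γ)
        (Nat.cast_le.1 (length_le_of_mem_cylinder h)))
    · obtain ⟨z, hz, hz'⟩ := hne hγ h
      exact cylinder_subset_cylinder hz' hz (hmax _ ⟨δ, h, rfl⟩) (self_mem_cylinder γ)
  · push Not at hb
    choose γ hγ hlt using hb
    have hp : ∀ n, ∃ e, (γ n).edges[n]? = some e := fun n =>
      ⟨_, List.getElem?_eq_getElem (hlt n)⟩
    choose p hp using hp
    -- The chosen `γ n` need not be visibly compatible. Any two of their cylinder sets meet, and a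
    -- common path `z` compares their edges.
    have hedge : ∀ n, ∀ z ∈ cylinder (γ n), z.edge? n = some (p n) := fun n z hz =>
      (edge?_of_mem_cylinder hz (hlt n)).trans (hp n)
    let q : E.InfinitePath := ⟨p, fun n => by
      obtain ⟨z, hz, hz'⟩ := hne (hγ n) (hγ (n + 1))
      exact PathSpace.r_eq_s_of_edge? (hedge n z hz) (hedge _ z hz')⟩
    have hmem : ∀ δ : E.FinitePath, cylinder δ ∈ 𝒰 → PathSpace.inf q ∈ cylinder δ := by
      intro δ hδ
      refine mem_cylinder_iff.2 ⟨?_, fun n hn => ?_⟩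
      · obtain ⟨z, hz, hz'⟩ := hne (hγ 0) hδ
        exact (PathSpace.src_eq_of_edge?_zero (hedge 0 z hz)).trans (src_of_mem_cylinder hz')
      · obtain ⟨z, hz, hz'⟩ := hne (hγ n) hδ
        rw [← edge?_of_mem_cylinder hz' hn, hedge n z hz]
        rfl
    refine ⟨.inf q, fun δ => ⟨fun h => ?_, hmem δ⟩⟩
    exact Filter.mem_of_superset (hγ δ.length)
      (cylinder_subset_cylinder h (hmem _ (hγ _)) (hlt _).le)

/-- Membership in an ultrafilter respects complements and finite intersections; this is where `F`
must be finite. -/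
theorem mem_genCylinder_iff_mem_ultrafilter {𝒰 : Ultrafilter E.PathSpace} {x : E.PathSpace}
    (hx : ∀ γ : E.FinitePath, x ∈ cylinder γ ↔ cylinder γ ∈ 𝒰) {α : E.FinitePath} {F : Set A}
    (hF : F.Finite) (hF' : F ⊆ E.outEdges α.range) :
    x ∈ genCylinder α F ↔ genCylinder α F ∈ 𝒰 := by
  have h : genCylinder α F = cylinder α ∩ ⋂ e ∈ F, {y | ∃ h : e ∈ E.outEdges α.range,
      y ∈ cylinder (α.snoc e h)}ᶜ := by
    ext y
    simp [genCylinder]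
  have h1 : ∀ e (he : e ∈ F), {y | ∃ h : e ∈ E.outEdges α.range, y ∈ cylinder (α.snoc e h)}
      = cylinder (α.snoc e (hF' he)) := by
    intro e he
    ext y
    exact ⟨fun h => h.2, fun h => ⟨hF' he, h⟩⟩
  rw [h, mem_inter_iff, ← Ultrafilter.mem_coe, Filter.inter_mem_iff, Filter.biInter_mem hF,
    mem_iInter₂, Ultrafilter.mem_coe, hx]
  refine and_congr_right' (forall₂_congr fun e he => ?_)
  rw [h1 e he, mem_compl_iff, hx, Ultrafilter.mem_coe, Ultrafilter.compl_mem_iff_notMem]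

theorem fin_eq_of_mem_genCylinder {α : E.FinitePath} {x : E.PathSpace}
    (h : x ∈ genCylinder α (E.outEdges α.range)) : x = .fin α := by
  rw [mem_genCylinder Subset.rfl] at h
  obtain ⟨⟨y, hy, rfl⟩, he⟩ := h
  have hnone : y.edge? 0 = none := by
    by_contra h0
    obtain ⟨e, h1⟩ := Option.ne_none_iff_exists'.1 h0
    refine he e ((PathSpace.src_eq_of_edge?_zero h1).trans hy.symm) ?_
    rw [PathSpace.edge?_concat]
    simpa using h1
  rcases y with ⟨w, b, hb⟩ | p
  · obtain rfl : b = [] := by simpa [PathSpace.edge?] using hnone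
    exact congrArg PathSpace.fin (FinitePath.ext rfl (List.append_nil _))
  · cases hnone

theorem isCompact_genCylinder_inter_boundary {α : E.FinitePath} {F : Set A} (hF : F.Finite)
    (hF' : F ⊆ E.outEdges α.range) : IsCompact (genCylinder α F ∩ E.boundary) := by
  rw [isCompact_iff_ultrafilter_le_nhds']
  intro 𝒰 h𝒰
  have hα : genCylinder α F ∈ 𝒰 := Filter.mem_of_superset h𝒰 inter_subset_left
  have hbd : E.boundary ∈ 𝒰 := Filter.mem_of_superset h𝒰 inter_subset_right
  obtain ⟨x, hx⟩ := exists_forall_mem_cylinder_iff 𝒰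
    (Filter.mem_of_superset hα (genCylinder_subset α F))
  refine ⟨x, ⟨(mem_genCylinder_iff_mem_ultrafilter hx hF hF').2 hα, ?_⟩, ?_⟩
  · rcases x with γ | p
    · by_contra hsing
      -- At a regular vertex all emitted edges may be excluded at once. The resulting set `{γ}` is
      -- in `𝒰`, hence meets `∂E`, so `γ` would be a boundary path.
      have hfin : (E.outEdges γ.range).Finite := not_infinite.1 fun h => hsing (.inr h)
      have hmem : PathSpace.fin γ ∈ genCylinder γ (E.outEdges γ.range) := by
        refine (mem_genCylinder Subset.rfl).2 ⟨self_mem_cylinder γ, fun e _ h => ?_⟩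
        have : γ.edges[γ.edges.length]? = some e := h
        simp at this
      rw [mem_genCylinder_iff_mem_ultrafilter hx hfin Subset.rfl] at hmem
      obtain ⟨z, hz, hz'⟩ := 𝒰.nonempty_of_mem (Filter.inter_mem hmem hbd)
      obtain rfl := fin_eq_of_mem_genCylinder hz
      exact hsing hz'
    · trivial
  · rw [nhds_generateFrom]
    refine le_iInf₂ fun U hU => Filter.le_principal_iff.2 ?_
    obtain ⟨hxU, γ, H, hH, hH', rfl⟩ := hU
    exact (mem_genCylinder_iff_mem_ultrafilter hx hH hH').1 hxU

/-! ### Boundary paths -/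

theorem concat_mem_boundary_iff {α : E.FinitePath} {x : E.PathSpace} (h : α.range = x.src) :
    α.concat x h ∈ E.boundary ↔ x ∈ E.boundary := by
  rcases x with β | p
  · exact iff_of_eq (congrArg E.IsSingular (range_append h))
  · exact Iff.rfl

theorem nonempty_boundaryPath (E : DirectedGraph V A) (v : V) : Nonempty E.BoundaryPath := by
  by_cases hs : ∃ w, E.IsSingular w
  · obtain ⟨w, hw⟩ := hs
    exact ⟨⟨.fin (vertex w), hw⟩⟩
  -- Without singular vertices every vertex emits an edge, and following chosen edges from `v` gives
  -- an infinite path.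
  · have hne : ∀ w, ∃ e, E.s e = w := fun w =>
      nonempty_iff_ne_empty.2 fun h => hs ⟨w, .inl h⟩
    choose f hf using hne
    refine ⟨⟨.inf ⟨fun n => f ((fun w => E.r (f w))^[n] v), fun n => ?_⟩, trivial⟩⟩
    rw [hf, Function.iterate_succ_apply']

/-! ### The sets `Z(α, β, F)` -/

namespace BoundaryMorphism

/-- The inverse `(y, -k, x)` of `(x, k, y)`. -/
def inv (g : E.BoundaryMorphism) : E.BoundaryMorphism := E.boundaryPathGroupoid.i g

theorem inv_inv (g : E.BoundaryMorphism) : g.inv.inv = g := E.boundaryPathGroupoid.i_i g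

end BoundaryMorphism

open BoundaryMorphism

section bisection

variable {α β γ : E.FinitePath} {F : Set A} {g g' : E.BoundaryMorphism}

theorem left_mem_cylinder (h : g ∈ bisection α β) : g.left.1 ∈ cylinder α := by
  obtain ⟨x, hα, hβ, hl, -, -⟩ := h
  exact hl ▸ concat_mem_cylinder hα

theorem right_mem_cylinder (h : g ∈ bisection α β) : g.right.1 ∈ cylinder β := by
  obtain ⟨x, hα, hβ, -, -, hr⟩ := h
  exact hr ▸ concat_mem_cylinder hβ

theorem lag_eq (h : g ∈ bisection α β) : g.lag = (α.length : ℤ) - β.length := by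
  obtain ⟨x, hα, hβ, -, hk, -⟩ := h
  exact hk

theorem range_eq_range (h : g ∈ bisection α β) : α.range = β.range := by
  obtain ⟨x, hα, hβ, -⟩ := h
  exact hα.trans hβ.symm

theorem exists_mem_bisection (g : E.BoundaryMorphism) :
    ∃ α β : E.FinitePath, g ∈ bisection α β := by
  obtain ⟨n, m, hk, hn, hm, h⟩ := g.tailEquiv
  obtain ⟨α, x, hx, rfl, hα⟩ := PathSpace.exists_concat hn
  obtain ⟨β, y, hy, rfl, hβ⟩ := PathSpace.exists_concat hm
  rw [← hα, ← hβ, PathSpace.shift_iterate_concat, PathSpace.shift_iterate_concat] at h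
  subst h
  refine ⟨α, β, ⟨x, ?_⟩, hx, hy, hα.symm, by omega, hβ.symm⟩
  rw [← concat_mem_boundary_iff hx, hα]
  exact g.left.2

theorem inv_mem_bisection (h : g ∈ bisection α β) : g.inv ∈ bisection β α := by
  obtain ⟨x, hα, hβ, hl, hk, hr⟩ := h
  refine ⟨x, hβ, hα, hr, ?_, hl⟩
  change -g.lag = _
  omega

theorem inv_mem_bisection_iff : g.inv ∈ bisection α β ↔ g ∈ bisection β α :=
  ⟨fun h => g.inv_inv ▸ inv_mem_bisection h, inv_mem_bisection⟩

theorem eq_of_left_eq (h : g ∈ bisection α β) (h' : g' ∈ bisection α β)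
    (hl : g.left = g'.left) : g = g' := by
  obtain ⟨x, hα, hβ, h1, h2, h3⟩ := h
  obtain ⟨y, hα', hβ', h1', h2', h3'⟩ := h'
  have hxy : x = y := by
    refine Subtype.ext (concat_right_injective (hx := hα) (hy := hα') ?_)
    rw [← h1, hl, h1']
  subst hxy
  exact BoundaryMorphism.ext hl (h2.trans h2'.symm) (Subtype.ext (h3.trans h3'.symm))

theorem exists_left_eq (hr : α.range = β.range) {x : E.BoundaryPath} (hx : x.1 ∈ cylinder α) :
    ∃ g ∈ bisection α β, g.left = x := by
  obtain ⟨x, hxb⟩ := x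
  obtain ⟨y, hy, rfl⟩ := hx
  have hy' := hr.symm.trans hy
  have hyb := (concat_mem_boundary_iff hy).1 hxb
  refine ⟨⟨⟨α.concat y hy, hxb⟩, (α.length : ℤ) - β.length,
    ⟨β.concat y hy', (concat_mem_boundary_iff hy').2 hyb⟩, ?_⟩,
    ⟨⟨y, hyb⟩, hy, hy', rfl, rfl, rfl⟩, rfl⟩
  exact ⟨α.length, β.length, by omega, length_le_of_mem_cylinder (concat_mem_cylinder hy),
    length_le_of_mem_cylinder (concat_mem_cylinder hy'),
    (PathSpace.shift_iterate_concat hy).trans (PathSpace.shift_iterate_concat hy').symm⟩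

/-- Writing `γ = α η`, the same segment `η` also follows `β` in the right end of `g`; take `δ = β
η`. -/
theorem exists_bisection_subset (h : g ∈ bisection α β) (hγ : g.left.1 ∈ cylinder γ)
    (hl : α.length ≤ γ.length) :
    ∃ δ, g ∈ bisection γ δ ∧ bisection γ δ ⊆ bisection α β := by
  obtain ⟨x, hα, hβ, h1, h2, h3⟩ := h
  obtain ⟨y, hy, hγy⟩ := hγ
  obtain ⟨η, hη, hηy, rfl, hx⟩ := exists_eq_append (h1.symm.trans hγy.symm) hl
  have hη' : β.range = η.src := (hβ.trans hα.symm).trans hη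
  obtain ⟨x, hxb⟩ := x
  dsimp only at hx
  subst hx
  refine ⟨β.append η hη', ⟨⟨y, (concat_mem_boundary_iff hηy).1 hxb⟩, hy,
    (range_append hη').trans hηy, hγy.symm, ?_, ?_⟩, ?_⟩
  · rw [h2, length_append, length_append]; push_cast; ring
  · rw [h3, concat_append (h := hη') (hx := hηy)]
  · rintro g' ⟨z, hz, hz', h1', h2', h3'⟩
    have hηz : η.range = z.1.src := (range_append hη).symm.trans hz
    refine ⟨⟨η.concat z.1 hηz, (concat_mem_boundary_iff hηz).2 z.2⟩,
      hη.trans (PathSpace.src_concat hηz).symm, hη'.trans (PathSpace.src_concat hηz).symm,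
      ?_, ?_, ?_⟩
    · rw [h1', concat_append (h := hη) (hx := hηz)]
    · rw [h2', length_append, length_append]; push_cast; ring
    · rw [h3', concat_append (h := hη') (hx := hηz)]

/-- The lag fixes the length of the second path, which is an initial segment of the right end. -/
theorem eq_of_mem_bisection (h : g ∈ bisection α β) (h' : g ∈ bisection α γ) : β = γ := by
  refine eq_of_mem_cylinder (right_mem_cylinder h) (right_mem_cylinder h') ?_
  have := (lag_eq h).symm.trans (lag_eq h')
  omega

theorem edge?_right (h : g ∈ bisection α β) (n : ℕ) :
    g.right.1.edge? (β.length + n) = g.left.1.edge? (α.length + n) := by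
  obtain ⟨x, hα, hβ, h1, h2, h3⟩ := h
  rw [h1, h3, PathSpace.edge?_concat, PathSpace.edge?_concat]
  simp

/-- The two ends agree after `α` and `β`, so `e` follows `β` as soon as it follows `α`. -/
theorem mem_bisection_snoc {e : A} (h : g ∈ bisection α β) (hα : e ∈ E.outEdges α.range)
    (hβ : e ∈ E.outEdges β.range) :
    g ∈ bisection (α.snoc e hα) (β.snoc e hβ) ↔ g.left.1 ∈ cylinder (α.snoc e hα) := by
  refine ⟨left_mem_cylinder, fun hl => ?_⟩
  obtain ⟨δ, hδ, -⟩ := exists_bisection_subset h hl (by rw [length_snoc]; omega)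
  have hδl := (lag_eq h).symm.trans (lag_eq hδ)
  rw [length_snoc] at hδl
  obtain rfl : β.snoc e hβ = δ := by
    refine eq_of_mem_cylinder ((mem_cylinder_snoc hβ).2 ⟨right_mem_cylinder h, ?_⟩)
      (right_mem_cylinder hδ) (by rw [length_snoc]; omega)
    rw [← ((mem_cylinder_snoc hα).1 hl).2]
    exact edge?_right h 0
  exact hδ

/-- Within `Z(α, β)`, excluding edges is a condition on the left end alone. This carries statements
about generalised cylinder sets over to the groupoid. -/
theorem mem_genBisection (hr : α.range = β.range) :
    g ∈ genBisection α β F ↔ g ∈ bisection α β ∧ g.left.1 ∈ genCylinder α F := by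
  simp only [genBisection, genCylinder, mem_sdiff, mem_iUnion, not_exists]
  constructor
  · rintro ⟨h, h'⟩
    exact ⟨h, left_mem_cylinder h, fun e he hα hl =>
      h' e he hα (hr ▸ hα) ((mem_bisection_snoc h hα (hr ▸ hα)).2 hl)⟩
  · rintro ⟨h, -, h'⟩
    exact ⟨h, fun e he hα hβ hm => h' e he hα (left_mem_cylinder hm)⟩

theorem genBisection_empty (α β : E.FinitePath) : genBisection α β ∅ = bisection α β := by
  simp [genBisection]

theorem inv_preimage_genBisection (α β : E.FinitePath) (F : Set A) :
    inv ⁻¹' genBisection α β F = genBisection β α F := by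
  ext g
  simp only [genBisection, mem_preimage, mem_sdiff, mem_iUnion, inv_mem_bisection_iff,
    not_exists]
  exact and_congr_right' ⟨fun h e he h1 h2 => h e he h2 h1, fun h e he h1 h2 => h e he h2 h1⟩

end bisection

/-! ### The topology of the boundary path groupoid -/

theorem isOpen_of_mem_basicBisections {U : Set E.BoundaryMorphism}
    (h : U ∈ E.basicBisections) : IsOpen U := .basic _ h

theorem bisection_mem_basicBisections {α β : E.FinitePath} (hr : α.range = β.range) :
    bisection α β ∈ E.basicBisections :=
  ⟨α, β, ∅, hr, finite_empty, empty_subset _, (genBisection_empty α β).symm⟩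

theorem isOpen_bisection {α β : E.FinitePath} (hr : α.range = β.range) :
    IsOpen (bisection α β) := isOpen_of_mem_basicBisections (bisection_mem_basicBisections hr)

/-- Every neighbourhood given by `Z(α, β)` and `C(γ, H)` contains one of the form `Z(ζ, δ, K)`. -/
theorem exists_genBisection_subset {α β γ : E.FinitePath} {F H : Set A}
    {g : E.BoundaryMorphism} (hr : α.range = β.range)
    (hF : F.Finite) (hF' : F ⊆ E.outEdges α.range) (hH : H.Finite)
    (hH' : H ⊆ E.outEdges γ.range) (h : g ∈ genBisection α β F)
    (hγ : g.left.1 ∈ genCylinder γ H) :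
    ∃ U ∈ E.basicBisections, g ∈ U ∧ U ⊆ genBisection α β F ∧
      (α.length ≤ γ.length → ∃ δ, g ∈ bisection γ δ ∧ U ⊆ bisection γ δ) ∧
      ∀ g' ∈ U, g'.left.1 ∈ genCylinder γ H := by
  rw [mem_genBisection hr] at h
  -- The longer of `α` and `γ` serves as the first path of the new set.
  rcases le_total α.length γ.length with hl | hl
  · obtain ⟨K, hK, hK', hgK, hKF, hKH⟩ :=
      exists_genCylinder_subset_inter hF hF' hH hH' h.2 hγ hl
    obtain ⟨δ, hδ, hsub⟩ := exists_bisection_subset h.1 hγ.1 hl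
    have hr' := range_eq_range hδ
    refine ⟨genBisection γ δ K, ⟨γ, δ, K, hr', hK, hK', rfl⟩, (mem_genBisection hr').2 ⟨hδ, hgK⟩,
      fun g' hg' => ?_, fun _ => ⟨δ, hδ, fun g' hg' => ((mem_genBisection hr').1 hg').1⟩,
      fun g' hg' => hKH ((mem_genBisection hr').1 hg').2⟩
    rw [mem_genBisection hr'] at hg'
    exact (mem_genBisection hr).2 ⟨hsub hg'.1, hKF hg'.2⟩
  · obtain ⟨K, hK, hK', hgK, hKH, hKF⟩ :=
      exists_genCylinder_subset_inter hH hH' hF hF' hγ h.2 hl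
    refine ⟨genBisection α β K, ⟨α, β, K, hr, hK, hK', rfl⟩, (mem_genBisection hr).2 ⟨h.1, hgK⟩,
      fun g' hg' => ?_, fun hl' => ?_, fun g' hg' => hKH ((mem_genBisection hr).1 hg').2⟩
    · rw [mem_genBisection hr] at hg' ⊢
      exact ⟨hg'.1, hKF hg'.2⟩
    · obtain rfl := eq_of_mem_cylinder hγ.1 h.2.1 (le_antisymm hl hl')
      exact ⟨β, h.1, fun g' hg' => ((mem_genBisection hr).1 hg').1⟩

theorem isTopologicalBasis_basicBisections (E : DirectedGraph V A) :
    IsTopologicalBasis E.basicBisections := by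
  refine ⟨?_, ?_, rfl⟩
  · have key : ∀ {α β γ δ : E.FinitePath} {F H : Set A} {g : E.BoundaryMorphism},
        α.range = β.range → γ.range = δ.range → F.Finite → F ⊆ E.outEdges α.range → H.Finite →
        H ⊆ E.outEdges γ.range → g ∈ genBisection α β F → g ∈ genBisection γ δ H →
        α.length ≤ γ.length → ∃ U ∈ E.basicBisections, g ∈ U ∧
          U ⊆ genBisection α β F ∧ U ⊆ genBisection γ δ H := by
      intro α β γ δ F H g hr hr' hF hF' hH hH' h h' hl
      have h'' := (mem_genBisection hr').1 h'
      obtain ⟨U, hU, hgU, hUF, hUγ, hUH⟩ :=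
        exists_genBisection_subset hr hF hF' hH hH' h h''.2
      obtain ⟨δ', hδ', hUδ⟩ := hUγ hl
      -- The second path found by refining `Z(α, β)` along `γ` has to be `δ`, since `g` lies in both
      -- sets.
      obtain rfl := eq_of_mem_bisection h''.1 hδ'
      exact ⟨U, hU, hgU, hUF, fun g' hg' => (mem_genBisection hr').2 ⟨hUδ hg', hUH g' hg'⟩⟩
    rintro _ ⟨α, β, F, hr, hF, hF', rfl⟩ _ ⟨γ, δ, H, hr', hH, hH', rfl⟩ g ⟨h, h'⟩
    rcases le_total α.length γ.length with hl | hl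
    · obtain ⟨U, hU, hg, h1, h2⟩ := key hr hr' hF hF' hH hH' h h' hl
      exact ⟨U, hU, hg, subset_inter h1 h2⟩
    · obtain ⟨U, hU, hg, h1, h2⟩ := key hr' hr hH hH' hF hF' h' h hl
      exact ⟨U, hU, hg, subset_inter h2 h1⟩
  · refine eq_univ_of_forall fun g => ?_
    obtain ⟨α, β, h⟩ := exists_mem_bisection g
    exact ⟨_, bisection_mem_basicBisections (range_eq_range h), h⟩

theorem continuous_inv : Continuous (inv : E.BoundaryMorphism → E.BoundaryMorphism) := by
  refine continuous_generateFrom_iff.2 ?_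
  rintro _ ⟨α, β, F, hr, hF, hF', rfl⟩
  rw [inv_preimage_genBisection]
  exact isOpen_of_mem_basicBisections ⟨β, α, F, hr.symm, hF, hr ▸ hF', rfl⟩

/-- Inversion as a homeomorphism. -/
def invHomeomorph : E.BoundaryMorphism ≃ₜ E.BoundaryMorphism where
  toFun := inv
  invFun := inv
  left_inv := inv_inv
  right_inv := inv_inv
  continuous_toFun := continuous_inv
  continuous_invFun := continuous_inv

/-! ### Codomain, domain and lag maps; the Hausdorff property -/

theorem continuous_left : Continuous (left : E.BoundaryMorphism → E.BoundaryPath) := by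
  refine Continuous.subtype_mk (continuous_generateFrom_iff.2 ?_) _
  rintro _ ⟨γ, H, hH, hH', rfl⟩
  refine isOpen_iff_forall_mem_open.2 fun g hg => ?_
  obtain ⟨α, β, h⟩ := exists_mem_bisection g
  obtain ⟨U, hU, hgU, -, -, hsub⟩ := exists_genBisection_subset (F := ∅) (range_eq_range h)
    finite_empty (empty_subset _) hH hH' ((genBisection_empty α β).symm ▸ h) hg
  exact ⟨U, hsub, isOpen_of_mem_basicBisections hU, hgU⟩

theorem continuous_right : Continuous (right : E.BoundaryMorphism → E.BoundaryPath) :=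
  continuous_left.comp continuous_inv

theorem left_image_genBisection {α β : E.FinitePath} (hr : α.range = β.range) (F : Set A) :
    left '' genBisection α β F = ((↑) : E.BoundaryPath → E.PathSpace) ⁻¹' genCylinder α F := by
  ext x
  constructor
  · rintro ⟨g, hg, rfl⟩
    exact ((mem_genBisection hr).1 hg).2
  · intro hx
    obtain ⟨g, hg, rfl⟩ := exists_left_eq hr (genCylinder_subset α F hx)
    exact ⟨g, (mem_genBisection hr).2 ⟨hg, hx⟩, rfl⟩

theorem isOpenMap_left : IsOpenMap (left : E.BoundaryMorphism → E.BoundaryPath) := by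
  refine (isTopologicalBasis_basicBisections E).isOpenMap_iff.2 ?_
  rintro _ ⟨α, β, F, hr, hF, hF', rfl⟩
  rw [left_image_genBisection hr]
  exact (isOpen_genCylinder hF hF').preimage continuous_subtype_val

theorem isOpenMap_right : IsOpenMap (right : E.BoundaryMorphism → E.BoundaryPath) :=
  isOpenMap_left.comp invHomeomorph.isOpenMap

theorem continuous_lag : Continuous (lag : E.BoundaryMorphism → ℤ) := by
  refine continuous_discrete_rng.2 fun k => isOpen_iff_forall_mem_open.2 fun g hg => ?_
  obtain ⟨α, β, h⟩ := exists_mem_bisection g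
  exact ⟨_, fun g' hg' => (lag_eq hg').trans ((lag_eq h).symm.trans hg),
    isOpen_bisection (range_eq_range h), h⟩

instance : T2Space E.BoundaryMorphism := by
  refine T2Space.of_injective_continuous
    (f := fun g : E.BoundaryMorphism => (g.left, g.lag, g.right)) ?_
    (continuous_left.prodMk (continuous_lag.prodMk continuous_right))
  intro g h hgh
  simp only [Prod.mk.injEq] at hgh
  exact BoundaryMorphism.ext hgh.1 hgh.2.1 hgh.2.2

/-! ### Compact open bisections and the unit space -/

theorem injOn_left {U : Set E.BoundaryMorphism} (hU : U ∈ E.basicBisections) :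
    InjOn left U := by
  obtain ⟨α, β, F, hr, hF, hF', rfl⟩ := hU
  exact fun g hg g' hg' h => eq_of_left_eq hg.1 hg'.1 h

theorem injOn_right {U : Set E.BoundaryMorphism} (hU : U ∈ E.basicBisections) :
    InjOn right U := by
  obtain ⟨α, β, F, hr, hF, hF', rfl⟩ := hU
  intro g hg g' hg' h
  exact invHomeomorph.injective
    (eq_of_left_eq (inv_mem_bisection hg.1) (inv_mem_bisection hg'.1) h)

/-- A continuous open map restricts to an open embedding of an open set on which it is
injective. -/
theorem isOpenEmbedding_restrict {X Y : Type*} [TopologicalSpace X] [TopologicalSpace Y]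
    {f : X → Y} (hc : Continuous f) (ho : IsOpenMap f) {U : Set X} (hU : IsOpen U)
    (hi : InjOn f U) : IsOpenEmbedding (fun x : U => f x) :=
  .of_continuous_injective_isOpenMap (hc.comp continuous_subtype_val)
    (injOn_iff_injective.1 hi) (ho.comp hU.isOpenMap_subtype_val)

/-- The codomain map embeds `Z(α, β, F)` onto the compact set `C(α, F) ∩ ∂E`. -/
theorem isCompact_of_mem_basicBisections {U : Set E.BoundaryMorphism}
    (hU : U ∈ E.basicBisections) : IsCompact U := by
  have he := isOpenEmbedding_restrict continuous_left isOpenMap_left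
    (isOpen_of_mem_basicBisections hU) (injOn_left hU)
  rw [isCompact_iff_isCompact_univ, he.isInducing.isCompact_iff, image_univ]
  have hrange : range (fun g : U => g.1.left) = left '' U := by
    rw [image_eq_range]
  obtain ⟨α, β, F, hr, hF, hF', rfl⟩ := hU
  rw [hrange, left_image_genBisection hr, Subtype.isCompact_iff, Subtype.image_preimage_coe,
    inter_comm]
  exact isCompact_genCylinder_inter_boundary hF hF'

theorem continuous_one : Continuous E.boundaryPathGroupoid.one := by
  refine continuous_generateFrom_iff.2 ?_
  rintro _ ⟨α, β, F, hr, hF, hF', rfl⟩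
  refine isOpen_iff_forall_mem_open.2 fun x hx => ?_
  have hx' := (mem_genBisection hr).1 hx
  -- A unit has lag `0`, so `α` and `β` are initial segments of `x` of equal length.
  obtain rfl : α = β := by
    refine eq_of_mem_cylinder (left_mem_cylinder hx'.1) (right_mem_cylinder hx'.1) ?_
    have : (0 : ℤ) = _ := lag_eq hx'.1
    omega
  refine ⟨((↑) : E.BoundaryPath → E.PathSpace) ⁻¹' genCylinder α F, fun y hy => ?_,
    (isOpen_genCylinder hF hF').preimage continuous_subtype_val, hx'.2⟩
  refine (mem_genBisection rfl).2 ⟨?_, hy⟩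
  obtain ⟨z, hz, hyz⟩ := genCylinder_subset α F hy
  refine ⟨⟨z, (concat_mem_boundary_iff hz).1 (hyz ▸ y.2)⟩, hz, hz, hyz.symm, ?_, hyz.symm⟩
  exact (sub_self _).symm

theorem isHomeomorph_toUnit (E : DirectedGraph V A) :
    IsHomeomorph E.boundaryPathGroupoid.toUnit := by
  have hc : Continuous E.boundaryPathGroupoid.toUnit := continuous_one.subtype_mk _
  refine isHomeomorph_iff_exists_inverse.2 ⟨hc, fun u => u.1.left, fun x => rfl, ?_,
    continuous_left.comp continuous_subtype_val⟩
  rintro ⟨_, x, rfl⟩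
  rfl

theorem isOpenBisection_of_mem_basicBisections {U : Set E.BoundaryMorphism}
    (hU : U ∈ E.basicBisections) : E.boundaryPathGroupoid.IsOpenBisection U where
  isOpen := isOpen_of_mem_basicBisections hU
  cod := (isHomeomorph_toUnit E).isOpenEmbedding.comp
    (isOpenEmbedding_restrict continuous_left isOpenMap_left
      (isOpen_of_mem_basicBisections hU) (injOn_left hU))
  dom := (isHomeomorph_toUnit E).isOpenEmbedding.comp
    (isOpenEmbedding_restrict continuous_right isOpenMap_right
      (isOpen_of_mem_basicBisections hU) (injOn_right hU))

/-! ### Continuity of the composition -/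

theorem comp_mem_bisection {α β γ : E.FinitePath} {g h : E.BoundaryMorphism}
    (hg : g ∈ bisection α β) (hh : h ∈ bisection β γ) (w : g.right = h.left) :
    E.boundaryPathGroupoid.m g h w ∈ bisection α γ := by
  obtain ⟨x, hα, hβ, h1, h2, h3⟩ := hg
  obtain ⟨y, hβ', hγ, h1', h2', h3'⟩ := hh
  have hxy : x = y := by
    refine Subtype.ext (concat_right_injective (hx := hβ) (hy := hβ') ?_)
    rw [← h3, w, h1']
  subst hxy
  refine ⟨x, hα, hγ, h1, ?_, h3'⟩
  change g.lag + h.lag = _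
  omega

theorem exists_bisection_subset_right {α β δ : E.FinitePath} {g : E.BoundaryMorphism}
    (h : g ∈ bisection α β) (hδ : g.right.1 ∈ cylinder δ) (hl : β.length ≤ δ.length) :
    ∃ γ, g ∈ bisection γ δ := by
  obtain ⟨γ, hγ, -⟩ := exists_bisection_subset (inv_mem_bisection h) hδ hl
  exact ⟨γ, inv_mem_bisection_iff.1 hγ⟩

/-- Composable morphisms lie in a pair of sets `Z(α, β)` and `Z(β, γ)`. -/
theorem exists_mem_bisection_of_composable {g h : E.BoundaryMorphism} (w : g.right = h.left) :
    ∃ α β γ : E.FinitePath, g ∈ bisection α β ∧ h ∈ bisection β γ := by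
  obtain ⟨α, β, hg⟩ := exists_mem_bisection g
  obtain ⟨β', γ, hh⟩ := exists_mem_bisection h
  -- Both `β` and `β'` are initial segments of the common middle path; the shorter one is lengthened
  -- to match the other.
  rcases le_total β.length β'.length with hl | hl
  · obtain ⟨α', hα'⟩ := exists_bisection_subset_right hg (w ▸ left_mem_cylinder hh) hl
    exact ⟨α', β', γ, hα', hh⟩
  · obtain ⟨γ', hγ', -⟩ := exists_bisection_subset hh (w ▸ right_mem_cylinder hg) hl
    exact ⟨α, β, γ', hg, hγ'⟩

theorem continuous_comp : Continuous E.boundaryPathGroupoid.comp := by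
  refine continuous_generateFrom_iff.2 fun U hU => isOpen_iff_forall_mem_open.2 ?_
  rintro ⟨⟨g, h⟩, w⟩ hgh
  change E.boundaryPathGroupoid.m g h w ∈ U at hgh
  obtain ⟨α, β, γ, hg, hh⟩ := exists_mem_bisection_of_composable w
  have hr := range_eq_range hg
  have hr' := range_eq_range hh
  have hm := comp_mem_bisection hg hh w
  -- If the left end of `g'` is that of some `u` in `U ∩ Z(α, γ)`, then the product `g' h'`, also in
  -- `Z(α, γ)` with this left end, equals `u`.
  have hW : IsOpen (left '' (U ∩ bisection α γ)) := isOpenMap_left _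
    ((isOpen_of_mem_basicBisections hU).inter (isOpen_bisection (hr.trans hr')))
  refine ⟨(↑) ⁻¹' ((bisection α β ∩ left ⁻¹' (left '' (U ∩ bisection α γ))) ×ˢ bisection β γ),
    ?_, ?_, ?_⟩
  · rintro ⟨⟨g', h'⟩, w'⟩ ⟨⟨hg', u, ⟨hu, hu'⟩, hleft⟩, hh'⟩
    change E.boundaryPathGroupoid.m g' h' w' ∈ U
    have := eq_of_left_eq hu' (comp_mem_bisection hg' hh' w') hleft
    exact this ▸ hu
  · exact (((isOpen_bisection hr).inter (hW.preimage continuous_left)).prod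
      (isOpen_bisection hr')).preimage continuous_subtype_val
  · exact ⟨⟨hg, _, ⟨hgh, hm⟩, rfl⟩, hh⟩

theorem isAmple_boundaryPathGroupoid (E : DirectedGraph V A) :
    E.boundaryPathGroupoid.IsAmple where
  isTopological := ⟨continuous_comp, continuous_inv⟩
  t2Space_unitSpace := inferInstance
  exists_basis := ⟨E.basicBisections, isTopologicalBasis_basicBisections E, fun _ hU =>
    ⟨isCompact_of_mem_basicBisections hU, isOpenBisection_of_mem_basicBisections hU⟩⟩

end DirectedGraph

theorem mainTheorem4 {V : Type*} {A : Type*} (E : DirectedGraph V A) :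
    (Nonempty V → Nonempty E.BoundaryMorphism) ∧
    T2Space E.BoundaryMorphism ∧
    E.boundaryPathGroupoid.IsAmple ∧
    IsTopologicalBasis E.basicBisections ∧
    (∀ U ∈ E.basicBisections, IsCompact U ∧ E.boundaryPathGroupoid.IsOpenBisection U) ∧
    IsHomeomorph E.boundaryPathGroupoid.toUnit :=
  ⟨fun ⟨v⟩ => (DirectedGraph.nonempty_boundaryPath E v).map E.boundaryPathGroupoid.one,
    inferInstance, DirectedGraph.isAmple_boundaryPathGroupoid E, DirectedGraph.isTopologicalBasis_basicBisections E,
    fun _ hU => ⟨DirectedGraph.isCompact_of_mem_basicBisections hU, DirectedGraph.isOpenBisection_of_mem_basicBisections hU⟩,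
    DirectedGraph.isHomeomorph_toUnit E⟩
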